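/- A set $S$ of natural numbers is called coprime-free if $\gcd(i,j)>1$ for all distinct $i,j\in S$. Let $\mathcal F_{143}$ be the family of coprime-free subsets of $\{1,\dots,143\}$, ordered by inclusion, and let $L=\mathcal F_{143}\cup\{\widehat 1\}$ be the lattice obtained by adjoining an artificial top element $\widehat 1$ (its bottom element is $\widehat 0=\emptyset$). Let $C$ be the set of coatoms of $L$, that is, the elements covered by $\widehat 1$, and let $\Delta_{143}$ be the cross-cut complex of $C$: the simplicial complex with vertex set $C$ whose faces are the subsets of $C$ that are not spanning, where a subset of $L$ is spanning if its join is $\widehat 1$ and its meet is $\widehat 0$. Then the second reduced simplicial homology group with integer coefficients is nontrivial: $\widetilde H_2(\Delta_{143})\neq 0$. -/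

import Mathlib

/-! ### Reduced simplicial homology over `ℤ` of a finite simplicial complex -/

section Homology

variable {V : Type*}

/-- The group of oriented `(n - 1)`-chains of `K` with integer coefficients: an oriented simplex on
`n` vertices is written as an `n`-tuple of distinct vertices spanning a face, and a chain is an
integer valued function of such tuples that is multiplied by the sign of a permutation when the
vertices are permuted (and is zero on all other tuples). The empty set counts as a face, so the
chains with `n = 0` form the group `ℤ` in degree `-1` of the augmented complex. -/
def orientedChains (K : PreAbstractSimplicialComplex V) (n : ℕ) :
    Submodule ℤ ((Fin n → V) → ℤ) where
  carrier := {c |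
    (∀ (σ : Equiv.Perm (Fin n)) (t : Fin n → V), c (t ∘ σ) = (Equiv.Perm.sign σ : ℤ) * c t) ∧
    ∀ t : Fin n → V, c t ≠ 0 →
      Function.Injective t ∧ ∃ s ∈ insert ∅ K.faces, (s : Set V) = Set.range t}
  add_mem' := by
    rintro a b ⟨ha, ha'⟩ ⟨hb, hb'⟩
    refine ⟨fun σ t => ?_, fun t ht => ?_⟩
    · simp only [Pi.add_apply, ha, hb, mul_add]
    · by_cases h : a t = 0
      · exact hb' t (by simpa [h] using ht)
      · exact ha' t h
  zero_mem' := by simp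
  smul_mem' := by
    rintro r a ⟨ha, ha'⟩
    refine ⟨fun σ t => ?_, fun t ht => ?_⟩
    · simp only [Pi.smul_apply, ha, smul_eq_mul]
      ring
    · exact ha' t (by intro h; simp [h] at ht)

/-- The coefficient formula for the boundary: the coefficient of `[t₁, …, tₙ]` in `∂ c` is the sum
over all vertices `v` of the coefficient of `[v, t₁, …, tₙ]` in `c`. -/
def boundaryFun [Fintype V] (n : ℕ) : ((Fin (n + 1) → V) → ℤ) →ₗ[ℤ] ((Fin n → V) → ℤ) where
  toFun c t := ∑ v : V, c (Fin.cons v t)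
  map_add' a b := by
    funext t
    simp [Finset.sum_add_distrib]
  map_smul' r a := by
    funext t
    simp [Finset.mul_sum]

theorem boundaryFun_mem [Fintype V] (K : PreAbstractSimplicialComplex V) (n : ℕ)
    (c : (Fin (n + 1) → V) → ℤ) (hc : c ∈ orientedChains K (n + 1)) :
    boundaryFun n c ∈ orientedChains K n := by
  obtain ⟨h1, h2⟩ := hc
  refine ⟨fun σ t => ?_, fun t ht => ?_⟩
  · simp only [boundaryFun, LinearMap.coe_mk, AddHom.coe_mk, Finset.mul_sum]
    refine Finset.sum_congr rfl fun v _ => ?_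
    have h := h1 (Equiv.Perm.decomposeFin.symm (0, σ)) (Fin.cons v t)
    rw [Equiv.Perm.decomposeFin.symm_sign] at h
    simp only [if_true, one_mul] at h
    rw [← h]
    congr 1
    funext i
    refine Fin.cases ?_ (fun j => ?_) i <;> simp
  · obtain ⟨v, -, hv⟩ := Finset.exists_ne_zero_of_sum_ne_zero ht
    obtain ⟨hinj, s, hs, hst⟩ := h2 _ hv
    have ht' : Function.Injective t := fun i j hij =>
      Fin.succ_injective _ (hinj (by simpa using hij))
    refine ⟨ht', Finset.univ.map ⟨t, ht'⟩, ?_, by simp⟩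
    have hsub : Finset.univ.map ⟨t, ht'⟩ ⊆ s := by
      intro x hx
      rw [← Finset.mem_coe, hst]
      obtain ⟨i, -, rfl⟩ := Finset.mem_map.1 hx
      exact ⟨i.succ, by simp⟩
    rcases Finset.eq_empty_or_nonempty (Finset.univ.map ⟨t, ht'⟩) with h0 | h0
    · exact Or.inl h0
    · rcases hs with hs | hs
      · rw [hs, Finset.subset_empty] at hsub
        exact Or.inl hsub
      · exact Or.inr ((K.isRelLowerSet_faces hs).2 hsub h0)

/-- The boundary map from `n`-chains to `(n - 1)`-chains; for `n = 0` it is the augmentation. -/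
def boundary [Fintype V] (K : PreAbstractSimplicialComplex V) (n : ℕ) :
    orientedChains K (n + 1) →ₗ[ℤ] orientedChains K n :=
  (boundaryFun n).restrict (boundaryFun_mem K n)

theorem boundary_boundary [Fintype V] (K : PreAbstractSimplicialComplex V) (n : ℕ)
    (c : orientedChains K (n + 2)) : boundary K n (boundary K (n + 1) c) = 0 := by
  obtain ⟨c, h1, h2⟩ := c
  ext t
  change ∑ v : V, ∑ w : V, c (Fin.cons w (Fin.cons v t : Fin (n + 1) → V)) = 0
  have key : ∀ v w : V, c (Fin.cons w (Fin.cons v t : Fin (n + 1) → V)) =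
      - c (Fin.cons v (Fin.cons w t : Fin (n + 1) → V)) := by
    intro v w
    have h := h1 (Equiv.swap 0 1) (Fin.cons v (Fin.cons w t : Fin (n + 1) → V))
    rw [Equiv.Perm.sign_swap (by simp)] at h
    simp only [Units.val_neg, Units.val_one, neg_mul, one_mul] at h
    rw [← h]
    congr 1
    funext i
    refine Fin.cases ?_ (fun j => Fin.cases ?_ (fun k => ?_) j) i
    · simp
    · simp
    · rw [Function.comp_apply, Equiv.swap_apply_of_ne_of_ne]
      · simp
      · exact Fin.succ_ne_zero _
      · intro h
        exact Fin.succ_ne_zero k (Fin.succ_injective _ h)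
  have hsum : ∑ v : V, ∑ w : V, c (Fin.cons w (Fin.cons v t : Fin (n + 1) → V)) =
      - ∑ v : V, ∑ w : V, c (Fin.cons w (Fin.cons v t : Fin (n + 1) → V)) := by
    conv_lhs => rw [Finset.sum_comm]
    simp only [← Finset.sum_neg_distrib]
    exact Finset.sum_congr rfl fun w _ => Finset.sum_congr rfl fun v _ => key v w
  omega

/-- The reduced simplicial homology group of `K` in degree `k`, with integer coefficients:
`k`-cycles (chains on `k + 1` vertices) modulo boundaries of `(k + 1)`-chains. -/
abbrev ReducedHomology [Fintype V] (K : PreAbstractSimplicialComplex V) (k : ℕ) : Type _ :=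
  LinearMap.ker (boundary K k) ⧸
    (LinearMap.range (boundary K (k + 1))).submoduleOf (LinearMap.ker (boundary K k))

end Homology

/-! ### Cross-cut complexes -/

section CrossCut

variable {L : Type*} [PartialOrder L] [BoundedOrder L]

/-- A set of elements is spanning if its join is the top element and its meet is the bottom
element. -/
def IsSpanning (S : Set L) : Prop := IsLUB S ⊤ ∧ IsGLB S ⊥

/-- The complex on the vertex set `C` whose faces are the (nonempty) finite subsets of `C` that are
not spanning. -/
def crossCutComplex (C : Set L) : PreAbstractSimplicialComplex L where
  faces := {s | s.Nonempty ∧ (s : Set L) ⊆ C ∧ ¬ IsSpanning (s : Set L)}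
  isRelLowerSet_faces := by
    rintro s ⟨hne, hC, hs⟩
    refine ⟨hne, fun t hts ht => ⟨ht, ?_, ?_⟩⟩
    · exact (Finset.coe_subset.2 hts).trans hC
    · rintro ⟨hl, hg⟩
      have hsub : (t : Set L) ⊆ (s : Set L) := Finset.coe_subset.2 hts
      exact hs ⟨⟨fun _ _ => le_top, fun b hb => hl.2 fun x hx => hb (hsub hx)⟩,
        ⟨fun _ _ => bot_le, fun b hb => hg.2 fun x hx => hb (hsub hx)⟩⟩

end CrossCut

/-! ### Coprime-free sets -/

/-- The family of finite coprime-free sets of natural numbers: any two distinct elements have a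
common factor greater than `1`. -/
def coprimeFreeFamily : Set (Finset ℕ) :=
  {S | ∀ i ∈ S, ∀ j ∈ S, i ≠ j → 1 < Nat.gcd i j}

/-- The members of the family that are subsets of `{1, …, n}`. -/
def coprimeFreeUpTo (n : ℕ) : Set (Finset ℕ) :=
  coprimeFreeFamily ∩ {S | S ⊆ Finset.Icc 1 n}

noncomputable instance (n : ℕ) : Fintype (coprimeFreeUpTo n) :=
  (((Finset.Icc 1 n).powerset.finite_toSet).subset fun _ hS =>
    Finset.mem_coe.2 (Finset.mem_powerset.2 hS.2)).fintype

instance (n : ℕ) : OrderBot (coprimeFreeUpTo n) where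
  bot := ⟨∅, by simp [coprimeFreeUpTo, coprimeFreeFamily]⟩
  bot_le S := Finset.empty_subset S.1

/-- The coprime-free subsets of `{1, …, n}`, ordered by inclusion, together with an artificial top
element. -/
abbrev CoprimeFreeLattice (n : ℕ) : Type := WithTop (coprimeFreeUpTo n)

/-- The cross-cut complex of the set of coatoms of the lattice of coprime-free subsets of
`{1, …, n}`. -/
def coatomComplex (n : ℕ) : PreAbstractSimplicialComplex (CoprimeFreeLattice n) :=
  crossCutComplex {x | IsCoatom x}

/-! ### Pushing simplicial chains forward along an injective vertex map. -/

section Chains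

variable {V W : Type*}

/-! Coatoms are the maximal coprime-free sets, and two or more of them form a face exactly when they
share a number. The products of two of the primes 5, 7, 11, 13 form three coprime pairs, 35 and 143,
55 and 91, 65 and 77; choosing one number from each pair gives eight coprime-free triples, the
vertices of a cube. Each square of the cube consists of the four triples through one of the six
numbers, so cutting it along a diagonal gives two faces of the complex. Extending the triples to
coatoms yields a 2-cycle on a sphere.

This cycle is not a boundary because of a cocycle supported at the coatom D through 77, 91, 143. The
bound 143 forces D to be exactly this set. A vertex of the link of D therefore meets {77, 91, 143}
in a nonempty proper subset, and falls into one of three classes: 77 without 143, 91 without 77, 143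
without 91. A simplex of the link has a common number, so it misses one class, and the link maps to
a circle. Counting edges from the first class to the second (`windingSum`) measures winding: it
kills boundaries (`windingSum_boundaryFun`) and is -1 on the sphere (`windingSum_tuplePush`). -/

theorem sum_sum_eq_zero_of_antisymm [Fintype V] (f : V → V → ℤ) (h : ∀ x y, f x y = -f y x) :
    ∑ x, ∑ y, f x y = 0 := by
  have h1 : ∑ x, ∑ y, f x y = -∑ x, ∑ y, f x y := by
    conv_lhs => rw [Finset.sum_comm]
    simp only [← Finset.sum_neg_distrib]
    exact Finset.sum_congr rfl fun x _ => Finset.sum_congr rfl fun y _ => h y x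
  omega

open Classical in
/-- The pushforward of a function on tuples along a map of vertices. -/
noncomputable def tuplePush [Fintype W] (j : W → V) (n : ℕ) (c : (Fin n → W) → ℤ) :
    (Fin n → V) → ℤ :=
  fun t => ∑ u : Fin n → W, if j ∘ u = t then c u else 0

theorem tuplePush_comp [Fintype W] {j : W → V} (hj : Function.Injective j) {n : ℕ}
    (c : (Fin n → W) → ℤ) (u : Fin n → W) : tuplePush j n c (j ∘ u) = c u := by
  classical
  unfold tuplePush
  rw [Finset.sum_eq_single u]
  · simp
  · intro b _ hb
    rw [if_neg fun h => hb (hj.comp_left h)]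
  · simp

theorem exists_of_tuplePush_ne_zero [Fintype W] {j : W → V} {n : ℕ}
    {c : (Fin n → W) → ℤ} {t : Fin n → V} (h : tuplePush j n c t ≠ 0) :
    ∃ u, j ∘ u = t ∧ c u ≠ 0 := by
  classical
  obtain ⟨u, -, hu⟩ := Finset.exists_ne_zero_of_sum_ne_zero h
  by_cases h' : j ∘ u = t
  · exact ⟨u, h', by simpa [h'] using hu⟩
  · simp [h'] at hu

theorem tuplePush_eq_zero [Fintype W] {j : W → V} {n : ℕ} {c : (Fin n → W) → ℤ} {t : Fin n → V}
    (h : ∀ u, j ∘ u ≠ t) : tuplePush j n c t = 0 := by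
  by_contra h0
  obtain ⟨u, hu, -⟩ := exists_of_tuplePush_ne_zero h0
  exact h u hu

theorem tuplePush_mem_orientedChains [Fintype W] {K : PreAbstractSimplicialComplex V} {j : W → V}
    (hj : Function.Injective j) {n : ℕ} {c : (Fin n → W) → ℤ}
    (hsign : ∀ (σ : Equiv.Perm (Fin n)) (u : Fin n → W),
      c (u ∘ σ) = (Equiv.Perm.sign σ : ℤ) * c u)
    (hface : ∀ u : Fin n → W, c u ≠ 0 → Function.Injective u ∧
      ∃ s ∈ K.faces, (s : Set V) = Set.range (j ∘ u)) :
    tuplePush j n c ∈ orientedChains K n := by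
  refine ⟨fun σ t => ?_, fun t ht => ?_⟩
  · by_cases h : ∃ u, j ∘ u = t
    · obtain ⟨u, rfl⟩ := h
      rw [Function.comp_assoc, tuplePush_comp hj, tuplePush_comp hj, hsign]
    · push Not at h
      rw [tuplePush_eq_zero h, tuplePush_eq_zero, mul_zero]
      intro u hu
      refine h (u ∘ σ.symm) ?_
      rw [← Function.comp_assoc, hu]
      funext i
      simp
  · obtain ⟨u, rfl, hu⟩ := exists_of_tuplePush_ne_zero ht
    obtain ⟨hi, s, hs, hst⟩ := hface u hu
    exact ⟨hj.comp hi, s, Or.inr hs, hst⟩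

/-- For injective `j` the pushforward is extension by zero, so a vertex outside the image of `j`
adds nothing to the boundary sum. -/
theorem boundaryFun_tuplePush_eq_zero [Fintype V] [Fintype W] {j : W → V}
    (hj : Function.Injective j) {n : ℕ} {c : (Fin (n + 1) → W) → ℤ}
    (hc : ∀ u : Fin n → W, ∑ w, c (Fin.cons w u) = 0) :
    boundaryFun n (tuplePush j (n + 1) c) = 0 := by
  classical
  funext t
  change ∑ v : V, tuplePush j (n + 1) c (Fin.cons v t) = 0
  by_cases h : ∃ u, j ∘ u = t
  · obtain ⟨u, rfl⟩ := h
    have hcons : ∀ w, (Fin.cons (j w) (j ∘ u) : Fin (n + 1) → V) = j ∘ Fin.cons w u := by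
      intro w
      funext i
      refine Fin.cases ?_ (fun k => ?_) i <;> simp
    rw [← hc u, ← Finset.sum_subset (Finset.subset_univ (Finset.univ.map ⟨j, hj⟩)),
      Finset.sum_map]
    · refine Finset.sum_congr rfl fun w _ => ?_
      rw [Function.Embedding.coeFn_mk, hcons, tuplePush_comp hj]
    · intro v _ hv
      refine tuplePush_eq_zero fun x hx => hv ?_
      exact Finset.mem_map.2 ⟨x 0, Finset.mem_univ _, by simpa using congrFun hx 0⟩
  · refine Finset.sum_eq_zero fun v _ => tuplePush_eq_zero fun x hx => h ⟨Fin.tail x, ?_⟩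
    funext i
    simpa [Fin.tail] using congrFun hx i.succ

end Chains

/-! ### A triangulated sphere with eight vertices -/

/-- The positively oriented triangles: the four faces of a tetrahedron on `0, 1, 2, 3`,
each subdivided at its barycentre; `4 + m` is the barycentre of the face opposite to `m`. -/
def sphereTriangles : List (Fin 8 × Fin 8 × Fin 8) :=
  [(4, 1, 2), (4, 2, 3), (4, 3, 1), (5, 2, 0), (5, 3, 2), (5, 0, 3),
    (6, 0, 1), (6, 1, 3), (6, 3, 0), (7, 1, 0), (7, 2, 1), (7, 0, 2)]

/-- The coefficient `1` on the listed ordered triangles. -/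
def sphereCoeff (a b c : Fin 8) : ℤ := if (a, b, c) ∈ sphereTriangles then 1 else 0

/-- The fundamental cycle of the sphere. -/
def sphereCycle (u : Fin 3 → Fin 8) : ℤ :=
  sphereCoeff (u 0) (u 1) (u 2) + sphereCoeff (u 1) (u 2) (u 0) + sphereCoeff (u 2) (u 0) (u 1) -
  sphereCoeff (u 1) (u 0) (u 2) - sphereCoeff (u 0) (u 2) (u 1) - sphereCoeff (u 2) (u 1) (u 0)

/-- The labels of the vertices of the sphere. -/
def sphereLabel : Fin 8 → Finset ℕ :=
  ![{35, 55, 65}, {35, 77, 91}, {55, 77, 143}, {65, 91, 143},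
    {77, 91, 143}, {55, 65, 143}, {35, 65, 91}, {35, 55, 77}]

theorem sphereCycle_comp_perm (σ : Equiv.Perm (Fin 3)) (u : Fin 3 → Fin 8) :
    sphereCycle (u ∘ σ) = (Equiv.Perm.sign σ : ℤ) * sphereCycle u := by
  -- Explicit tuples reduce the claim to a finite check.
  have key : ∀ σ : Equiv.Perm (Fin 3), ∀ a b c : Fin 8,
      sphereCycle (![a, b, c] ∘ σ) = (Equiv.Perm.sign σ : ℤ) * sphereCycle ![a, b, c] := by
    decide +kernel
  have hu : u = ![u 0, u 1, u 2] := by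
    funext i
    fin_cases i <;> rfl
  rw [hu]
  exact key σ _ _ _

theorem sum_sphereCycle_cons (u : Fin 2 → Fin 8) :
    ∑ w, sphereCycle (Fin.cons w u) = 0 := by
  have key : ∀ a b : Fin 8, ∑ w, sphereCycle ![w, a, b] = 0 := by decide +kernel
  have hu : u = ![u 0, u 1] := by
    funext i
    fin_cases i <;> rfl
  rw [hu]
  exact key _ _

theorem injective_and_exists_label_of_sphereCycle_ne_zero (u : Fin 3 → Fin 8)
    (h : sphereCycle u ≠ 0) :
    Function.Injective u ∧ ∃ x, ∀ i, x ∈ sphereLabel (u i) := by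
  have key : ∀ a b c : Fin 8, sphereCycle ![a, b, c] ≠ 0 → (a ≠ b ∧ a ≠ c ∧ b ≠ c) ∧
      ∃ x ∈ ({35, 55, 65, 77, 91, 143} : Finset ℕ),
        x ∈ sphereLabel a ∧ x ∈ sphereLabel b ∧ x ∈ sphereLabel c := by decide +kernel
  have hu : u = ![u 0, u 1, u 2] := by
    funext i
    fin_cases i <;> rfl
  rw [hu] at h
  obtain ⟨⟨h1, h2, h3⟩, x, -, h4, h5, h6⟩ := key _ _ _ h
  refine ⟨?_, x, ?_⟩
  · intro i k hik
    fin_cases i <;> fin_cases k <;> first | rfl | exact absurd hik ‹_› | exact absurd hik.symm ‹_›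
  · intro i
    fin_cases i
    exacts [h4, h5, h6]

/-! ### Coatoms of the lattice of coprime-free sets -/

section Coatoms

variable {n : ℕ}

/-- The number `x` belongs to the element `A` of the lattice, and `A` is not the top element. -/
def LatticeMem (x : ℕ) (A : CoprimeFreeLattice n) : Prop :=
  ∃ S : coprimeFreeUpTo n, A = (S : CoprimeFreeLattice n) ∧ x ∈ S.1

theorem LatticeMem.mem_Icc {x : ℕ} {A : CoprimeFreeLattice n} (h : LatticeMem x A) :
    x ∈ Finset.Icc 1 n := by
  obtain ⟨S, -, hx⟩ := h
  exact S.2.2 hx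

theorem LatticeMem.gcd {x y : ℕ} {A : CoprimeFreeLattice n} (hx : LatticeMem x A)
    (hy : LatticeMem y A) (hxy : x ≠ y) : 1 < Nat.gcd x y := by
  obtain ⟨S, rfl, hx⟩ := hx
  obtain ⟨T, hT, hy⟩ := hy
  obtain rfl := WithTop.coe_injective hT
  exact S.2.1 x hx y hy hxy

theorem exists_coatom_of_coprimeFree (T : Finset ℕ) (hT : T ∈ coprimeFreeUpTo n) :
    ∃ A : CoprimeFreeLattice n, IsCoatom A ∧ ∀ x ∈ T, LatticeMem x A := by
  obtain h | ⟨A, hA, hle⟩ :=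
    eq_top_or_exists_le_coatom ((⟨T, hT⟩ : coprimeFreeUpTo n) : CoprimeFreeLattice n)
  · exact absurd h (WithTop.coe_ne_top)
  · refine ⟨A, hA, fun x hx => ?_⟩
    obtain ⟨S, rfl⟩ := WithTop.ne_top_iff_exists.1 hA.1
    exact ⟨S, rfl, WithTop.coe_le_coe.1 hle hx⟩

theorem eq_of_coatom_of_forall_latticeMem {A B : CoprimeFreeLattice n} (hA : IsCoatom A)
    (hB : IsCoatom B) (h : ∀ x, LatticeMem x A → LatticeMem x B) : A = B := by
  obtain ⟨S, rfl⟩ := WithTop.ne_top_iff_exists.1 hA.1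
  obtain ⟨T, rfl⟩ := WithTop.ne_top_iff_exists.1 hB.1
  have hle : (S : CoprimeFreeLattice n) ≤ T := by
    refine WithTop.coe_le_coe.2 fun x hx => ?_
    obtain ⟨T', hT', hx'⟩ := h x ⟨S, rfl, hx⟩
    obtain rfl := WithTop.coe_injective hT'
    exact hx'
  by_contra hne
  exact hB.1 (hA.2 _ (lt_of_le_of_ne hle hne))

/-- The singleton `{x}` is itself coprime-free, so it is a nonzero lower bound and the meet cannot
be the bottom. -/
theorem mem_coatomComplex_of_common {s : Finset (CoprimeFreeLattice n)} (hs : s.Nonempty)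
    (hc : ∀ A ∈ s, IsCoatom A) {x : ℕ} (hx : ∀ A ∈ s, LatticeMem x A) :
    s ∈ (coatomComplex n).faces := by
  refine ⟨hs, fun A hA => hc A hA, fun hsp => ?_⟩
  obtain ⟨A, hA⟩ := hs
  have hmem : ({x} : Finset ℕ) ∈ coprimeFreeUpTo n := by
    refine ⟨?_, by simpa using (hx A hA).mem_Icc⟩
    intro i hi k hk hik
    simp only [Finset.mem_singleton] at hi hk
    exact absurd (hi.trans hk.symm) hik
  have hle : ((⟨{x}, hmem⟩ : coprimeFreeUpTo n) : CoprimeFreeLattice n) ≤ ⊥ := by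
    refine hsp.2.2 fun B hB => ?_
    obtain ⟨S, rfl, hxS⟩ := hx B hB
    exact WithTop.coe_le_coe.2 (Finset.singleton_subset_iff.2 hxS)
  have hle' : (⟨{x}, hmem⟩ : coprimeFreeUpTo n) ≤ ⊥ := WithTop.coe_le_coe.1 hle
  exact absurd (hle' (Finset.mem_singleton_self x)) (Finset.notMem_empty x)

/-- Two distinct coatoms already join to the top, so a face containing them can fail to span only
through its meet, which must then contain a number. -/
theorem exists_common_of_mem_coatomComplex {s : Finset (CoprimeFreeLattice n)}
    (hs : s ∈ (coatomComplex n).faces) {A B : CoprimeFreeLattice n} (hA : A ∈ s) (hB : B ∈ s)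
    (hAB : A ≠ B) : ∃ x, ∀ C ∈ s, LatticeMem x C := by
  obtain ⟨-, hc, hsp⟩ := hs
  have hc' : ∀ C ∈ s, IsCoatom C := fun C hC => hc hC
  have hlub : IsLUB (s : Set (CoprimeFreeLattice n)) ⊤ := by
    refine ⟨fun _ _ => le_top, fun b hb => ?_⟩
    by_contra hne
    have h1 : ∀ C ∈ s, C = b := fun C hC => by
      by_contra hCb
      exact hne ((hc' C hC).2 b (lt_of_le_of_ne (hb hC) hCb)).ge
    exact hAB ((h1 A hA).trans (h1 B hB).symm)
  have hglb : ¬ IsGLB (s : Set (CoprimeFreeLattice n)) ⊥ := fun h => hsp ⟨hlub, h⟩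
  by_contra hno
  push Not at hno
  refine hglb ⟨fun _ _ => bot_le, fun b hb => ?_⟩
  obtain ⟨S, rfl⟩ := WithTop.ne_top_iff_exists.1
    (ne_top_of_le_ne_top (hc' A hA).1 (hb hA))
  suffices hbot : S ≤ ⊥ from WithTop.coe_le_coe.2 hbot
  intro x hx
  obtain ⟨C, hC, hxC⟩ := hno x
  obtain ⟨T, rfl⟩ := WithTop.ne_top_iff_exists.1 (hc' C hC).1
  exact absurd ⟨T, rfl, WithTop.coe_le_coe.1 (hb hC) hx⟩ hxC

end Coatoms

/-! ### The cocycle -/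

open Classical in
/-- The sum of the coefficients of `[D, A, B]` in `c` over all `A` containing `77` but not `143`
and all `B` containing `91` but not `77`. -/
noncomputable def windingSum (D : CoprimeFreeLattice 143)
    (c : (Fin 3 → CoprimeFreeLattice 143) → ℤ) : ℤ :=
  ∑ A, ∑ B, if (LatticeMem 77 A ∧ ¬ LatticeMem 143 A) ∧ LatticeMem 91 B ∧ ¬ LatticeMem 77 B
    then c ![D, A, B] else 0

/-- A number sharing a prime with each of 77, 91, 143 is divisible by two of 7, 11, 13, hence by one
of these products; the least proper multiple of any of them is 154, beyond the bound. -/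
theorem latticeMem_cases {D : CoprimeFreeLattice 143} (h : ∀ x ∈ sphereLabel 4, LatticeMem x D)
    {x : ℕ} (hx : LatticeMem x D) : x = 77 ∨ x = 91 ∨ x = 143 := by
  have key : ∀ x ∈ Finset.Icc 1 143, (x ≠ 77 → 1 < Nat.gcd x 77) → (x ≠ 91 → 1 < Nat.gcd x 91) →
      (x ≠ 143 → 1 < Nat.gcd x 143) → x = 77 ∨ x = 91 ∨ x = 143 := by decide +kernel
  exact key x hx.mem_Icc (hx.gcd (h 77 (by decide))) (hx.gcd (h 91 (by decide)))
    (hx.gcd (h 143 (by decide)))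

/-- In a tetrahedron `[v, D, A, B]` that contributes, `v` lies in the class of `A` or in that of
`B`. Exchanging `v` with the vertex of its own class reverses the sign, so the contributions cancel.
-/
theorem windingSum_boundaryFun {D : CoprimeFreeLattice 143} (hD : IsCoatom D)
    (hmem : ∀ x ∈ sphereLabel 4, LatticeMem x D)
    {e : (Fin 4 → CoprimeFreeLattice 143) → ℤ} (he : e ∈ orientedChains (coatomComplex 143) 4) :
    windingSum D (boundaryFun 3 e) = 0 := by
  classical
  set P : CoprimeFreeLattice 143 → Prop := fun A => LatticeMem 77 A ∧ ¬ LatticeMem 143 A with hP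
  set Q : CoprimeFreeLattice 143 → Prop := fun B => LatticeMem 91 B ∧ ¬ LatticeMem 77 B with hQ
  have hswap02 : ∀ v A B, e ![v, D, A, B] = -e ![A, D, v, B] := by
    intro v A B
    have h := he.1 (Equiv.swap 0 2) ![A, D, v, B]
    rw [Equiv.Perm.sign_swap (by decide)] at h
    simp only [Units.val_neg, Units.val_one, neg_mul, one_mul] at h
    rw [← h]
    congr 1
    funext i
    fin_cases i <;> rfl
  have hswap03 : ∀ v A B, e ![v, D, A, B] = -e ![B, D, A, v] := by
    intro v A B
    have h := he.1 (Equiv.swap 0 3) ![B, D, A, v]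
    rw [Equiv.Perm.sign_swap (by decide)] at h
    simp only [Units.val_neg, Units.val_one, neg_mul, one_mul] at h
    rw [← h]
    congr 1
    funext i
    fin_cases i <;> rfl
  have hsplit : ∀ v A B, (if P A ∧ Q B then e ![v, D, A, B] else 0) =
      (if P v ∧ P A ∧ Q B then e ![v, D, A, B] else 0) +
      (if Q v ∧ P A ∧ Q B then e ![v, D, A, B] else 0) := by
    intro v A B
    by_cases h0 : e ![v, D, A, B] = 0
    · simp [h0]
    by_cases hAB : P A ∧ Q B
    swap
    · simp [hAB]
    obtain ⟨hA, hB⟩ := hAB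
    obtain ⟨hinj, s, hs, hst⟩ := he.2 _ h0
    have hrange : ∀ i, ![v, D, A, B] i ∈ s := fun i => by
      rw [← Finset.mem_coe, hst]
      exact ⟨i, rfl⟩
    have hface : s ∈ (coatomComplex 143).faces := by
      rcases hs with rfl | hs
      · exact absurd (hrange 0) (by simp)
      · exact hs
    have hvD : v ≠ D := fun h => absurd (@hinj 0 1 h) (by decide)
    obtain ⟨x, hx⟩ := exists_common_of_mem_coatomComplex hface (hrange 0) (hrange 1) hvD
    have hxv : LatticeMem x v := hx _ (hrange 0)
    have hxD : LatticeMem x D := hx _ (hrange 1)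
    have hxA : LatticeMem x A := hx _ (hrange 2)
    have hxB : LatticeMem x B := hx _ (hrange 3)
    -- The common number lies in `D`; 77 is excluded by `B` and 143 by `A`.
    have hx91 : x = 91 := by
      rcases latticeMem_cases hmem hxD with rfl | rfl | rfl
      · exact absurd hxB hB.2
      · rfl
      · exact absurd hxA hA.2
    subst hx91
    have hv : IsCoatom v := hface.2.1 (hrange 0)
    by_cases h77 : LatticeMem 77 v
    · have h143 : ¬ LatticeMem 143 v := fun h143 => by
        refine hvD (eq_of_coatom_of_forall_latticeMem hD hv fun y hy => ?_).symm
        rcases latticeMem_cases hmem hy with rfl | rfl | rfl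
        exacts [h77, hxv, h143]
      have hPv : P v := ⟨h77, h143⟩
      have hQv : ¬ Q v := fun h => h.2 h77
      simp [hA, hB, hPv, hQv]
    · have hPv : ¬ P v := fun h => h77 h.1
      have hQv : Q v := ⟨hxv, h77⟩
      simp [hA, hB, hPv, hQv]
  have hexp : windingSum D (boundaryFun 3 e) =
      ∑ A, ∑ B, ∑ v, if P A ∧ Q B then e ![v, D, A, B] else 0 := by
    refine Finset.sum_congr rfl fun A _ => Finset.sum_congr rfl fun B _ => ?_
    by_cases h : P A ∧ Q B
    · rw [if_pos h]
      simp only [if_pos h]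
      rfl
    · rw [if_neg h]
      simp only [if_neg h, Finset.sum_const_zero]
  rw [hexp]
  simp only [hsplit, Finset.sum_add_distrib]
  have h1 : ∑ A, ∑ B, ∑ v, (if P v ∧ P A ∧ Q B then e ![v, D, A, B] else 0) = 0 := by
    rw [Finset.sum_comm]
    refine Finset.sum_eq_zero fun B _ => sum_sum_eq_zero_of_antisymm _ fun A v => ?_
    by_cases h : P v ∧ P A ∧ Q B
    · rw [if_pos h, if_pos ⟨h.2.1, h.1, h.2.2⟩, hswap02]
    · rw [if_neg h, if_neg fun h' => h ⟨h'.2.1, h'.1, h'.2.2⟩, neg_zero]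
  have h2 : ∑ A, ∑ B, ∑ v, (if Q v ∧ P A ∧ Q B then e ![v, D, A, B] else 0) = 0 := by
    refine Finset.sum_eq_zero fun A _ => sum_sum_eq_zero_of_antisymm _ fun B v => ?_
    by_cases h : Q v ∧ P A ∧ Q B
    · rw [if_pos h, if_pos ⟨h.2.2, h.2.1, h.1⟩, hswap03]
    · rw [if_neg h, if_neg fun h' => h ⟨h'.2.2, h'.2.1, h'.1⟩, neg_zero]
  rw [h1, h2, add_zero]

theorem windingSum_tuplePush {j : Fin 8 → CoprimeFreeLattice 143} (hj : Function.Injective j)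
    (hlabel : ∀ i, ∀ x ∈ sphereLabel i, LatticeMem x (j i)) :
    windingSum (j 4) (tuplePush j 3 sphereCycle) = -1 := by
  classical
  have hnot : ∀ i x y, y ∈ sphereLabel i → x ≠ y → ¬ 1 < Nat.gcd x y → ¬ LatticeMem x (j i) :=
    fun i x y hy hxy hg hx => hg (hx.gcd (hlabel i y hy) hxy)
  have key : ∀ a b : Fin 8, sphereCycle ![4, a, b] ≠ 0 → (a = 1 ∨ a = 2 ∨ a = 3) ∧
      (b = 1 ∨ b = 2 ∨ b = 3) := by decide +kernel
  -- The listed positive triangle is `(4, 3, 1)`, the opposite orientation.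
  have hval : tuplePush j 3 sphereCycle ![j 4, j 1, j 3] = -1 := by
    have h : ![j 4, j 1, j 3] = j ∘ ![4, 1, 3] := by
      funext i
      fin_cases i <;> rfl
    rw [h, tuplePush_comp hj]
    decide
  have hzero : ∀ A B, ((LatticeMem 77 A ∧ ¬ LatticeMem 143 A) ∧
      LatticeMem 91 B ∧ ¬ LatticeMem 77 B) → tuplePush j 3 sphereCycle ![j 4, A, B] ≠ 0 →
      A = j 1 ∧ B = j 3 := by
    rintro A B ⟨⟨hA1, hA2⟩, hB1, hB2⟩ h
    obtain ⟨u, hu, hne⟩ := exists_of_tuplePush_ne_zero h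
    have h0 : u 0 = 4 := hj (congrFun hu 0)
    have h1 : j (u 1) = A := congrFun hu 1
    have h2 : j (u 2) = B := congrFun hu 2
    have hu' : u = ![4, u 1, u 2] := by
      rw [← h0]
      funext i
      fin_cases i <;> rfl
    rw [hu'] at hne
    obtain ⟨ha, hb⟩ := key _ _ hne
    subst h1 h2
    constructor
    -- Around vertex 4 the neighbours are 1, 2, 3; the conditions leave only 1 for `A` and only 3
    -- for `B`.
    · rcases ha with ha | ha | ha <;> rw [ha] at hA1 hA2 ⊢
      · exact absurd (hlabel 2 143 (by decide)) hA2
      · exact absurd (hlabel 3 143 (by decide)) hA2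
    · rcases hb with hb | hb | hb <;> rw [hb] at hB1 hB2 ⊢
      · exact absurd (hlabel 1 77 (by decide)) hB2
      · exact absurd (hlabel 2 77 (by decide)) hB2
  unfold windingSum
  rw [Finset.sum_eq_single (j 1), Finset.sum_eq_single (j 3), if_pos, hval]
  · exact ⟨⟨hlabel 1 77 (by decide), hnot 1 143 35 (by decide) (by decide) (by decide)⟩,
      hlabel 3 91 (by decide), hnot 3 77 65 (by decide) (by decide) (by decide)⟩
  · intro B _ hB
    split_ifs with h
    · by_contra h'
      exact hB (hzero _ _ h h').2
    · rfl
  · simp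
  · intro A _ hA
    refine Finset.sum_eq_zero fun B _ => ?_
    split_ifs with h
    · by_contra h'
      exact hA (hzero _ _ h h').1
    · rfl
  · simp

/-! ### Embedding the sphere into the coatoms, and the conclusion. -/

theorem exists_injective_coatoms : ∃ j : Fin 8 → CoprimeFreeLattice 143, Function.Injective j ∧
    (∀ i, IsCoatom (j i)) ∧ ∀ i, ∀ x ∈ sphereLabel i, LatticeMem x (j i) := by
  have hfree : ∀ i : Fin 8, sphereLabel i ∈ coprimeFreeUpTo 143 := by
    have h1 : ∀ i : Fin 8, ∀ x ∈ sphereLabel i, ∀ y ∈ sphereLabel i, x ≠ y → 1 < Nat.gcd x y := by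
      decide +kernel
    have h2 : ∀ i : Fin 8, sphereLabel i ⊆ Finset.Icc 1 143 := by decide +kernel
    exact fun i => ⟨h1 i, h2 i⟩
  choose j hj hlabel using fun i => exists_coatom_of_coprimeFree (sphereLabel i) (hfree i)
  refine ⟨j, fun i k hik => ?_, hj, hlabel⟩
  by_contra hne
  -- Different labels choose differently from one of the three coprime pairs, so no coatom contains
  -- both.
  have key : ∀ i k : Fin 8, i ≠ k → ∃ x ∈ sphereLabel i, ∃ y ∈ sphereLabel k,
      x ≠ y ∧ ¬ 1 < Nat.gcd x y := by decide +kernel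
  obtain ⟨x, hx, y, hy, hxy, hg⟩ := key i k hne
  exact hg ((hlabel i x hx).gcd (hik ▸ hlabel k y hy) hxy)

theorem proposition8 : Nontrivial (ReducedHomology (coatomComplex 143) 2) := by
  classical
  obtain ⟨j, hj, hcoatom, hlabel⟩ := exists_injective_coatoms
  have hz : tuplePush j 3 sphereCycle ∈ orientedChains (coatomComplex 143) 3 := by
    refine tuplePush_mem_orientedChains hj sphereCycle_comp_perm fun u hu => ?_
    obtain ⟨hinj, x, hx⟩ := injective_and_exists_label_of_sphereCycle_ne_zero u hu
    refine ⟨hinj, Finset.univ.image (j ∘ u), mem_coatomComplex_of_common (x := x) ?_ ?_ ?_, ?_⟩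
    · exact ⟨j (u 0), Finset.mem_image_of_mem _ (Finset.mem_univ 0)⟩
    · simp [hcoatom]
    · simpa using fun i => hlabel _ _ (hx i)
    · rw [Finset.coe_image, Finset.coe_univ, Set.image_univ]
  have hcycle : boundary (coatomComplex 143) 2 ⟨_, hz⟩ = 0 :=
    Subtype.ext (boundaryFun_tuplePush_eq_zero hj sum_sphereCycle_cons)
  refine Submodule.Quotient.nontrivial_iff.2 fun htop => ?_
  have hmem : (⟨⟨_, hz⟩, hcycle⟩ : LinearMap.ker (boundary (coatomComplex 143) 2)) ∈
      (LinearMap.range (boundary (coatomComplex 143) 3)).submoduleOf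
        (LinearMap.ker (boundary (coatomComplex 143) 2)) := htop ▸ Submodule.mem_top
  obtain ⟨e, he⟩ := hmem
  have he' : boundaryFun 3 e.1 = tuplePush j 3 sphereCycle := congrArg Subtype.val he
  have h0 := windingSum_boundaryFun (hcoatom 4) (hlabel 4) e.2
  rw [he', windingSum_tuplePush hj hlabel] at h0
  exact absurd h0 (by decide)
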